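/- Let $b\ge 0$ and let $\nu$ be a measure on $(0,\infty)$ with $\int_{(0,\infty)}(1\wedge y)\,\nu(dy)<\infty$. Let $$\phi(x)=bx+\int_{(0,\infty)}(1-e^{-xy})\,\nu(dy),\qquad x\ge 0,$$ be the corresponding Bernstein function without killing term, assume that $\phi(1)=1$, and denote by $\phi^{-1}$ its inverse function. For $m\in\mathbb N=\{1,2,\dots\}$ put $$c(\phi,m)=\frac1{m!}\int_{(0,\infty)}y^m e^{-y}\,\nu(dy)+b\,\mathbf 1_{\{m=1\}};$$ these numbers form a probability distribution on $\mathbb N$. Let $T_n=\sum_{k=1}^n R_k$, $n\in\mathbb N$, where $R_1,R_2,\dots$ are i.i.d. random variables with $\mathbb P(R_k=m)=c(\phi,m)$ for $m\in\mathbb N$ (that is, $T$ is a discrete time subordinator associated with $\phi$). (a) Let $\theta>0$ and $\delta\in(0,1]$. If $\nu(dy)\ge c\,y^{-1-\alpha}\,dy$ on $(0,\infty)$ for some constants $c>0$ and $\alpha\in(0,1)$, then there is a constant $C=C(\theta,\delta,c,\alpha)>0$, depending only on the indicated parameters, such that $$\mathbb E\,e^{-\theta T_n^\delta}\le \exp\left[-C\,n^{\frac{\delta}{\alpha(1-\delta)+\delta}}\right]\quad\text{for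 all sufficiently large } n\in\mathbb N.$$ (b) Let $\beta>0$. If $$\liminf_{x\to\infty}\frac{\phi(x)}{\log x}>0\qquad\text{and}\qquad \liminf_{x\downarrow 0}\frac{\phi(\lambda x)}{\phi(x)}>1\ \text{ for some }\lambda>1,$$ then there is a constant $C>0$, depending only on $\beta$ and $\phi$, such that $$\mathbb E\,T_n^{-\beta}\le C\left[\phi^{-1}\left(\tfrac1n\right)\right]^\beta\quad\text{for all } n\in\mathbb N.$$ (c) Let $\gamma>0$. If $\nu(dy)\ge c\,y^{-1-\alpha}\,dy$ on $(0,\infty)$ for some constants $c>0$ and $\alpha\in(0,1)$, then there is a constant $C=C(\gamma,c,\alpha)>0$, depending only on the indicated parameters, such that $$\mathbb E\,\log^{-\gamma}(1+T_n)\le C\log^{-\gamma}(1+n)\quad\text{for all } n\in\mathbb N.$$ -/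

import Mathlib

open MeasureTheory ProbabilityTheory Filter Topology Set

namespace DiscreteSubordination

/-- `b ≥ 0` is a drift and `ν` is a Lévy measure on `(0, ∞)`, i.e. a Borel measure on the line
carried by `(0, ∞)` with `∫ (1 ∧ y) ν(dy) < ∞`. (Such a measure is automatically finite on the
compact subsets of `(0, ∞)`, hence Radon there.) -/
structure IsLevyPair (b : ℝ) (ν : Measure ℝ) : Prop where
  drift_nonneg : 0 ≤ b
  carried : ν (Iic 0) = 0
  integral_lt_top : ∫⁻ y in Ioi (0 : ℝ), ENNReal.ofReal (min 1 y) ∂ν < ⊤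

/-- The Bernstein function without killing term
`φ(x) = b x + ∫_{(0,∞)} (1 - e^{-x y}) ν(dy)`, `x ≥ 0`. -/
noncomputable def bernsteinFn (b : ℝ) (ν : Measure ℝ) (x : ℝ) : ℝ :=
  b * x + ∫ y in Ioi (0 : ℝ), (1 - Real.exp (-(x * y))) ∂ν

/-- The inverse of the Bernstein function `φ : [0, ∞) → [0, ∞)` (used on the range of `φ`). -/
noncomputable def bernsteinInv (b : ℝ) (ν : Measure ℝ) : ℝ → ℝ :=
  Function.invFunOn (bernsteinFn b ν) (Ici 0)

/-- The weights `c(φ, m) = (1 / m!) ∫_{(0,∞)} y^m e^{-y} ν(dy) + b 1_{m = 1}`, for `m ≥ 1`. -/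
noncomputable def weight (b : ℝ) (ν : Measure ℝ) (m : ℕ) : ℝ :=
  1 / (m.factorial : ℝ) * (∫ y in Ioi (0 : ℝ), y ^ m * Real.exp (-y) ∂ν) + if m = 1 then b else 0

/-- `T` is a discrete time subordinator associated with the Bernstein function of `(b, ν)`:
`T n` is the sum of the first `n` terms of an i.i.d. sequence of positive integer valued random
variables with law `(c(φ, m))_{m ≥ 1}`. Here `R k` is the `(k + 1)`-st step; as the weights
`c(φ, m)`, `m ≥ 1`, sum up to `φ 1 = 1`, each step is a.s. at least `1`. -/
def IsDiscreteSubordinator (b : ℝ) (ν : Measure ℝ) {Ω : Type*} [MeasurableSpace Ω]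
    (P : Measure Ω) (T : ℕ → Ω → ℕ) : Prop :=
  ∃ R : ℕ → Ω → ℕ,
    (∀ k, Measurable (R k)) ∧
    iIndepFun R P ∧
    (∀ k m, 1 ≤ m → P {ω | R k ω = m} = ENNReal.ofReal (weight b ν m)) ∧
    ∀ n ω, T n ω = ∑ k ∈ Finset.range n, R k ω

/-- `ν(dy) ≥ c y^{-1-α} dy` on `(0, ∞)`, as an inequality between measures. -/
def StableLowerBound (c α : ℝ) (ν : Measure ℝ) : Prop :=
  (volume.restrict (Ioi (0 : ℝ))).withDensity (fun y => ENNReal.ofReal (c * y ^ (-1 - α))) ≤ ν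

/-- The growth conditions `liminf_{x → ∞} φ(x) / log x > 0` and
`liminf_{x ↓ 0} φ(l x) / φ(x) > 1` for some `l > 1`. The lower limits are taken in the extended
reals, since the quotients may tend to `∞`. -/
def GrowthCondition (φ : ℝ → ℝ) : Prop :=
  0 < liminf (fun x : ℝ => ((φ x / Real.log x : ℝ) : EReal)) atTop ∧
  ∃ l : ℝ, 1 < l ∧ 1 < liminf (fun x : ℝ => ((φ (l * x) / φ x : ℝ) : EReal)) (𝓝[>] 0)

end DiscreteSubordination

/-!
The whole argument runs through the Laplace transform of `T n`. Expanding the exponential under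
the integral against `ν` gives the generating function `∑ c(φ, m) s ^ m = φ 1 - φ (1 - s)` of the
weights (`IsLevyPair.hasSum_weight`). At `s = 1` it shows that the steps are a.s. at least `1`, so
that `T n ≥ n` a.s. (`IsDiscreteSubordinator.ae_le`); the logarithmic moments follow at once, with
constant `1`. By independence `E e^{-u T n} = (1 - φ (1 - e^{-u})) ^ n`, and concavity of `φ` turns
this into `E e^{-u T n} ≤ exp (-n φ(u) / 2)` for `u ≤ 1`
(`IsDiscreteSubordinator.integral_exp_le_half`).

For the sub-exponential moments, the lower bound on `ν` gives `φ x ≥ (c / 8) x ^ α`, and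
`e^{-θ T^δ}` is split according to `T ≥ t` or `T ≤ t`, the second event being controlled by
`e^{u (t - T)}`. Optimizing over `t` and `u` makes all exponents of order `n ^ (δ / D)` with
`D = α (1 - δ) + δ` (`IsDiscreteSubordinator.integral_exp_rpow_le`).

For the algebraic moments, let `a = φ⁻¹ (1 / n)`. On the layer where `1 / T` is between `l ^ k * a`
and `l ^ (k + 1) * a`, the power `T ^ (-β)` is at most `a ^ β * l ^ ((k + 1) β)` times
`e * exp (-l ^ k * a * T)`. The scaling condition near `0` makes `n φ (l ^ k * a)` at least a
constant times `ρ ^ k` with `ρ > 1`, so the layers sum up to a constant times `a ^ β`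
(`IsDiscreteSubordinator.integral_rpow_neg_le`). Only layers with `l ^ k * a ≤ 1` occur, because
`T n ≥ 1` a.s.
-/

namespace DiscreteSubordination

variable {b : ℝ} {ν : Measure ℝ}

/-! ### Bernstein functions -/

lemma one_sub_exp_nonneg {x y : ℝ} (hx : 0 ≤ x) (hy : 0 ≤ y) : 0 ≤ 1 - Real.exp (-(x * y)) := by
  have : Real.exp (-(x * y)) ≤ 1 := Real.exp_le_one_iff.2 (by nlinarith [mul_nonneg hx hy])
  linarith

lemma half_le_one_sub_exp_neg {u : ℝ} (h0 : 0 ≤ u) (h1 : u ≤ 1) :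
    u / 2 ≤ 1 - Real.exp (-u) := by
  have h : 1 + u ≤ Real.exp u := by linarith [Real.add_one_le_exp u]
  have : Real.exp (-u) ≤ 1 / (1 + u) := by
    rw [Real.exp_neg, ← one_div]
    exact one_div_le_one_div_of_le (by linarith) h
  have h2 : 1 / (1 + u) ≤ 1 - u / 2 := by
    rw [div_le_iff₀ (by linarith)]
    nlinarith
  linarith

lemma IsLevyPair.integrableOn_min (h : IsLevyPair b ν) :
    IntegrableOn (fun y : ℝ => min 1 y) (Ioi 0) ν := by
  refine ⟨by fun_prop, ?_⟩
  rw [hasFiniteIntegral_iff_ofReal]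
  · exact h.integral_lt_top
  · filter_upwards [ae_restrict_mem measurableSet_Ioi] with y hy
    exact le_min zero_le_one (le_of_lt hy)

lemma IsLevyPair.integrableOn_one_sub_exp (h : IsLevyPair b ν) {x : ℝ} (hx : 0 ≤ x) :
    IntegrableOn (fun y : ℝ => 1 - Real.exp (-(x * y))) (Ioi 0) ν := by
  refine Integrable.mono' (h.integrableOn_min.const_mul (max 1 x)) (by fun_prop) ?_
  filter_upwards [ae_restrict_mem measurableSet_Ioi] with y hy
  have hy : 0 < y := hy
  rw [Real.norm_of_nonneg (one_sub_exp_nonneg hx hy.le)]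
  rcases le_total 1 y with h1 | h1
  · rw [min_eq_left h1]
    linarith [le_max_left 1 x, Real.exp_pos (-(x * y))]
  · rw [min_eq_right h1]
    nlinarith [le_max_right 1 x, Real.add_one_le_exp (-(x * y))]

lemma bernsteinFn_zero : bernsteinFn b ν 0 = 0 := by
  simp [bernsteinFn]

lemma IsLevyPair.bernsteinFn_mono (h : IsLevyPair b ν) {x y : ℝ} (hx : 0 ≤ x) (hxy : x ≤ y) :
    bernsteinFn b ν x ≤ bernsteinFn b ν y := by
  refine add_le_add (mul_le_mul_of_nonneg_left hxy h.drift_nonneg) ?_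
  refine setIntegral_mono_on (h.integrableOn_one_sub_exp hx)
    (h.integrableOn_one_sub_exp (hx.trans hxy)) measurableSet_Ioi fun z hz => ?_
  have : x * z ≤ y * z := mul_le_mul_of_nonneg_right hxy (le_of_lt hz)
  gcongr

/-- Concavity of `φ` together with `φ 0 = 0`. -/
lemma IsLevyPair.mul_bernsteinFn_le (h : IsLevyPair b ν) {u x : ℝ} (hu0 : 0 ≤ u) (hu1 : u ≤ 1)
    (hx : 0 ≤ x) : u * bernsteinFn b ν x ≤ bernsteinFn b ν (u * x) := by
  unfold bernsteinFn
  rw [mul_add, ← integral_const_mul]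
  refine add_le_add (le_of_eq (by ring)) ?_
  refine setIntegral_mono_on ((h.integrableOn_one_sub_exp hx).const_mul u)
    (h.integrableOn_one_sub_exp (mul_nonneg hu0 hx)) measurableSet_Ioi fun z _ => ?_
  have := convexOn_exp.2 (mem_univ (-(x * z))) (mem_univ 0) hu0 (sub_nonneg.2 hu1) (by ring)
  simp only [smul_eq_mul, mul_zero, add_zero, Real.exp_zero, mul_one] at this
  rw [show -(u * x * z) = u * -(x * z) by ring]
  linarith

lemma IsLevyPair.continuousOn_bernsteinFn (h : IsLevyPair b ν) :
    ContinuousOn (bernsteinFn b ν) (Icc 0 1) := by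
  refine ContinuousOn.add (by fun_prop) ?_
  refine continuousOn_of_dominated (bound := fun y => 1 - Real.exp (-(1 * y)))
    (fun x _ => by fun_prop) (fun x hx => ?_)
    (h.integrableOn_one_sub_exp zero_le_one) (ae_of_all _ fun y => by fun_prop)
  filter_upwards [ae_restrict_mem measurableSet_Ioi] with y hy
  have hy : 0 < y := hy
  rw [Real.norm_of_nonneg (one_sub_exp_nonneg hx.1 hy.le)]
  have : x * y ≤ 1 * y := mul_le_mul_of_nonneg_right hx.2 hy.le
  gcongr

lemma IsLevyPair.bernsteinInv_spec (h : IsLevyPair b ν) (h1 : bernsteinFn b ν 1 = 1) {y : ℝ}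
    (hy0 : 0 < y) (hy1 : y ≤ 1) :
    0 < bernsteinInv b ν y ∧ bernsteinFn b ν (bernsteinInv b ν y) = y := by
  have hex : ∃ a ∈ Ici (0 : ℝ), bernsteinFn b ν a = y := by
    obtain ⟨a, ha, hay⟩ := intermediate_value_Icc zero_le_one h.continuousOn_bernsteinFn
      (show y ∈ Icc _ _ by rw [bernsteinFn_zero, h1]; exact ⟨hy0.le, hy1⟩)
    exact ⟨a, ha.1, hay⟩
  have hmem : bernsteinInv b ν y ∈ Ici (0 : ℝ) := Function.invFunOn_mem hex
  have heq : bernsteinFn b ν (bernsteinInv b ν y) = y := Function.invFunOn_eq hex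
  refine ⟨lt_of_le_of_ne hmem fun h0 => ?_, heq⟩
  rw [← h0, bernsteinFn_zero] at heq
  exact hy0.ne heq

/-- The part of `ν` on `(1/x, 2/x]`, where `1 - e^{-xy} ≥ 1/2`, already has mass of order
`x ^ α`. -/
lemma IsLevyPair.le_bernsteinFn_of_stableLowerBound (h : IsLevyPair b ν) {c α : ℝ} (hc : 0 < c)
    (hα0 : 0 < α) (hα1 : α < 1) (hν : StableLowerBound c α ν) {x : ℝ} (hx : 0 < x) :
    c / 8 * x ^ α ≤ bernsteinFn b ν x := by
  have hx' : 0 < x⁻¹ := inv_pos.2 hx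
  have hsub : Ioc x⁻¹ (2 * x⁻¹) ⊆ Ioi (0 : ℝ) := fun y hy => hx'.trans hy.1
  have hint := h.integrableOn_one_sub_exp hx.le
  have hhalf : ∀ y ∈ Ioc x⁻¹ (2 * x⁻¹), (1 / 2 : ℝ) ≤ 1 - Real.exp (-(x * y)) := by
    intro y hy
    have h1 : 1 ≤ x * y := by
      have := mul_le_mul_of_nonneg_left hy.1.le hx.le
      rwa [mul_inv_cancel₀ hx.ne'] at this
    have h2 := half_le_one_sub_exp_neg zero_le_one le_rfl
    have h3 : Real.exp (-(x * y)) ≤ Real.exp (-1) := by gcongr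
    linarith
  have hfin : ν (Ioc x⁻¹ (2 * x⁻¹)) ≠ ⊤ := by
    have := (hint.mono_set hsub).measure_norm_ge_lt_top (ε := 1 / 2) (by norm_num)
    refine ne_top_of_le_ne_top this.ne ?_
    rw [Measure.restrict_apply' measurableSet_Ioc]
    refine measure_mono fun y hy => ⟨?_, hy⟩
    exact (hhalf y hy).trans (le_abs_self _)
  have hmass : c / 4 * x ^ α ≤ ν.real (Ioc x⁻¹ (2 * x⁻¹)) := by
    have h1 := hν (Ioc x⁻¹ (2 * x⁻¹))
    rw [withDensity_apply _ measurableSet_Ioc, Measure.restrict_restrict measurableSet_Ioc,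
      inter_eq_left.2 hsub] at h1
    have h2 : ENNReal.ofReal (c / 4 * x ^ α) ≤
        ∫⁻ y in Ioc x⁻¹ (2 * x⁻¹), ENNReal.ofReal (c * y ^ (-1 - α)) := by
      calc ENNReal.ofReal (c / 4 * x ^ α)
          ≤ ENNReal.ofReal (c * (2 * x⁻¹) ^ (-1 - α)) * volume (Ioc x⁻¹ (2 * x⁻¹)) := by
            rw [Real.volume_Ioc, ← ENNReal.ofReal_mul (by positivity)]
            refine ENNReal.ofReal_le_ofReal ?_
            rw [Real.mul_rpow zero_le_two hx'.le, Real.inv_rpow hx.le, ← Real.rpow_neg hx.le,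
              show -(-1 - α) = α + 1 by ring, Real.rpow_add_one hx.ne']
            have h4 : (1 / 4 : ℝ) ≤ 2 ^ (-1 - α) := by
              calc (1 / 4 : ℝ) = 2 ^ (-2 : ℝ) := by
                    rw [Real.rpow_neg zero_le_two]; norm_num
                _ ≤ _ := Real.rpow_le_rpow_of_exponent_le one_le_two (by linarith)
            have h5 : c * (2 ^ (-1 - α) * (x ^ α * x)) * (2 * x⁻¹ - x⁻¹)
                = c * x ^ α * 2 ^ (-1 - α) := by
              field_simp; ring
            rw [h5]
            have : 0 < c * x ^ α := by positivity
            nlinarith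
        _ = ∫⁻ _ in Ioc x⁻¹ (2 * x⁻¹), ENNReal.ofReal (c * (2 * x⁻¹) ^ (-1 - α)) := by
            rw [setLIntegral_const]
        _ ≤ _ := by
            refine setLIntegral_mono' measurableSet_Ioc fun y hy => ENNReal.ofReal_le_ofReal ?_
            exact mul_le_mul_of_nonneg_left
              (Real.rpow_le_rpow_of_nonpos (hsub hy) hy.2 (by linarith)) hc.le
    exact (ENNReal.ofReal_le_iff_le_toReal hfin).1 (h2.trans h1)
  have hI : (1 / 2) * ν.real (Ioc x⁻¹ (2 * x⁻¹)) ≤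
      ∫ y in Ioi (0 : ℝ), (1 - Real.exp (-(x * y))) ∂ν := by
    calc (1 / 2) * ν.real (Ioc x⁻¹ (2 * x⁻¹))
        ≤ ∫ y in Ioc x⁻¹ (2 * x⁻¹), (1 - Real.exp (-(x * y))) ∂ν :=
          setIntegral_ge_of_const_le_real measurableSet_Ioc hfin hhalf (hint.mono_set hsub)
      _ ≤ _ := by
          refine setIntegral_mono_set hint ?_ hsub.eventuallyLE
          filter_upwards [ae_restrict_mem measurableSet_Ioi] with y hy
          exact one_sub_exp_nonneg hx.le (le_of_lt hy)
  have := mul_nonneg h.drift_nonneg hx.le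
  unfold bernsteinFn
  linarith

/-! ### The generating function of the weights -/

lemma weight_nonneg (h : IsLevyPair b ν) (m : ℕ) : 0 ≤ weight b ν m := by
  unfold weight
  have h1 : 0 ≤ ∫ y in Ioi (0 : ℝ), y ^ m * Real.exp (-y) ∂ν :=
    setIntegral_nonneg measurableSet_Ioi fun y hy => by
      have : (0 : ℝ) < y := hy
      positivity
  have h2 : 0 ≤ if m = 1 then b else 0 := by split_ifs <;> simp [h.drift_nonneg]
  positivity

/-- The generating function of the weights is `s ↦ φ 1 - φ (1 - s)`. It comes from expanding
`e^{sy} - 1` in powers of `s` under the integral `∫ e^{-y} (e^{sy} - 1) ν(dy)`. -/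
lemma IsLevyPair.hasSum_weight (h : IsLevyPair b ν) {s : ℝ} (hs0 : 0 ≤ s) (hs1 : s ≤ 1) :
    HasSum (fun m : ℕ => weight b ν (m + 1) * s ^ (m + 1))
      (bernsteinFn b ν 1 - bernsteinFn b ν (1 - s)) := by
  set F : ℕ → ℝ → ℝ := fun m y => (s * y) ^ (m + 1) / (m + 1).factorial * Real.exp (-y) with hF
  have hpt : ∀ y, HasSum (fun m => F m y)
      ((1 - Real.exp (-(1 * y))) - (1 - Real.exp (-((1 - s) * y)))) := by
    intro y
    have h1 := NormedSpace.expSeries_div_hasSum_exp (s * y)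
    rw [← Real.exp_eq_exp_ℝ, ← hasSum_nat_add_iff' 1] at h1
    have h2 := h1.mul_right (Real.exp (-y))
    have heq : (1 - Real.exp (-(1 * y))) - (1 - Real.exp (-((1 - s) * y)))
        = (Real.exp (s * y) - ∑ i ∈ Finset.range 1, (s * y) ^ i / i.factorial) * Real.exp (-y) := by
      simp only [Finset.range_one, Finset.sum_singleton, pow_zero, Nat.factorial_zero,
        Nat.cast_one, div_one, sub_mul, ← Real.exp_add, one_mul]
      ring_nf
    rw [heq]
    exact h2
  have hi1 := h.integrableOn_one_sub_exp zero_le_one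
  have hi2 := h.integrableOn_one_sub_exp (sub_nonneg.2 hs1)
  have hnn : ∀ m, ∀ y ∈ Ioi (0 : ℝ), 0 ≤ F m y := fun m y hy => by
    have : (0 : ℝ) < y := hy
    positivity
  have hsum : HasSum (fun m => ∫ y in Ioi (0 : ℝ), F m y ∂ν)
      (∫ y in Ioi (0 : ℝ), ((1 - Real.exp (-(1 * y))) - (1 - Real.exp (-((1 - s) * y)))) ∂ν) := by
    refine hasSum_integral_of_dominated_convergence F (fun m => by fun_prop) (fun m => ?_)
      (ae_of_all _ fun y => (hpt y).summable) ?_ (ae_of_all _ hpt)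
    · filter_upwards [ae_restrict_mem measurableSet_Ioi] with y hy
      rw [Real.norm_of_nonneg (hnn m y hy)]
    · simp_rw [fun y => (hpt y).tsum_eq]
      exact hi1.sub hi2
  rw [integral_sub hi1 hi2] at hsum
  have hb : HasSum (fun m : ℕ => if m = 0 then b * s else 0) (b * s) := by
    exact hasSum_ite_eq (0 : ℕ) (b * s)
  convert hsum.add hb using 1
  · funext m
    have : ∫ y in Ioi (0 : ℝ), F m y ∂ν
        = s ^ (m + 1) / (m + 1).factorial * ∫ y in Ioi (0 : ℝ), y ^ (m + 1) * Real.exp (-y) ∂ν := by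
      rw [← integral_const_mul]
      refine integral_congr_ae (ae_of_all _ fun y => ?_)
      simp only [hF]
      ring
    rw [this, weight]
    rcases m with _ | m
    · simp; ring
    · rw [if_neg (by omega), if_neg (by omega)]
      ring
  · unfold bernsteinFn; ring

variable {Ω : Type*} [MeasurableSpace Ω] {P : Measure Ω} [IsProbabilityMeasure P] {T : ℕ → Ω → ℕ}

/-! ### Laplace transform of the discrete subordinator -/

/-- The generating function of a step; the atom at `0` is not prescribed by the weights, and is
shown to vanish by taking `s = 1`. -/
lemma IsLevyPair.integral_pow_step_eq_add (h : IsLevyPair b ν) {R : Ω → ℕ} (hR : Measurable R)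
    (hlaw : ∀ m, 1 ≤ m → P {ω | R ω = m} = ENNReal.ofReal (weight b ν m))
    {s : ℝ} (hs0 : 0 ≤ s) (hs1 : s ≤ 1) :
    ∫ ω, s ^ R ω ∂P
      = P.real {ω | R ω = 0} + (bernsteinFn b ν 1 - bernsteinFn b ν (1 - s)) := by
  have hint : Integrable (fun m : ℕ => s ^ m) (P.map R) := by
    have := Measure.isProbabilityMeasure_map (μ := P) hR.aemeasurable
    refine Integrable.of_bound (by fun_prop) 1 (ae_of_all _ fun m => ?_)
    rw [Real.norm_of_nonneg (by positivity)]
    exact pow_le_one₀ hs0 hs1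
  have hsum := hasSum_integral_iUnion (μ := P.map R) (f := fun m : ℕ => s ^ m)
    (s := fun m : ℕ => {m}) (fun m => measurableSet_singleton m)
    (fun i j hij => by simpa using hij) hint.integrableOn
  rw [iUnion_of_singleton, Measure.restrict_univ, integral_map hR.aemeasurable (by fun_prop)]
    at hsum
  rw [← hasSum_nat_add_iff' 1] at hsum
  have hterm : ∀ m : ℕ, ∫ k in ({m} : Set ℕ), s ^ k ∂(P.map R) = P.real {ω | R ω = m} * s ^ m := by
    intro m
    rw [integral_singleton, map_measureReal_apply hR (measurableSet_singleton m)]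
    rfl
  simp only [hterm, Finset.range_one, Finset.sum_singleton, pow_zero, mul_one] at hsum
  have hw := h.hasSum_weight hs0 hs1
  have heq : (fun m : ℕ => P.real {ω | R ω = m + 1} * s ^ (m + 1))
      = fun m : ℕ => weight b ν (m + 1) * s ^ (m + 1) := by
    funext m
    rw [measureReal_def, hlaw (m + 1) (by omega), ENNReal.toReal_ofReal (weight_nonneg h _)]
  rw [heq] at hsum
  linarith [hsum.unique hw]

/-- A step is a.s. positive, because the weights `c(φ, m)`, `m ≥ 1`, sum up to `φ 1 = 1`. -/
lemma IsLevyPair.measureReal_step_eq_zero (h : IsLevyPair b ν) (h1 : bernsteinFn b ν 1 = 1)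
    {R : Ω → ℕ} (hR : Measurable R)
    (hlaw : ∀ m, 1 ≤ m → P {ω | R ω = m} = ENNReal.ofReal (weight b ν m)) :
    P.real {ω | R ω = 0} = 0 := by
  have := h.integral_pow_step_eq_add hR hlaw zero_le_one le_rfl
  simp only [one_pow, integral_const, probReal_univ, smul_eq_mul, mul_one, sub_self,
    bernsteinFn_zero, h1, sub_zero] at this
  linarith

lemma IsLevyPair.integral_pow_step (h : IsLevyPair b ν) (h1 : bernsteinFn b ν 1 = 1)
    {R : Ω → ℕ} (hR : Measurable R)
    (hlaw : ∀ m, 1 ≤ m → P {ω | R ω = m} = ENNReal.ofReal (weight b ν m))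
    {s : ℝ} (hs0 : 0 ≤ s) (hs1 : s ≤ 1) :
    ∫ ω, s ^ R ω ∂P = 1 - bernsteinFn b ν (1 - s) := by
  rw [h.integral_pow_step_eq_add hR hlaw hs0 hs1, h.measureReal_step_eq_zero h1 hR hlaw, h1, zero_add]

omit [IsProbabilityMeasure P] in
lemma IsDiscreteSubordinator.measurable (hT : IsDiscreteSubordinator b ν P T) (n : ℕ) :
    Measurable (T n) := by
  obtain ⟨R, hR, -, -, hsum⟩ := hT
  rw [show T n = fun ω => ∑ k ∈ Finset.range n, R k ω from funext (hsum n)]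
  fun_prop

lemma IsDiscreteSubordinator.ae_le (hT : IsDiscreteSubordinator b ν P T) (h : IsLevyPair b ν)
    (h1 : bernsteinFn b ν 1 = 1) (n : ℕ) : ∀ᵐ ω ∂P, n ≤ T n ω := by
  obtain ⟨R, hR, -, hlaw, hsum⟩ := hT
  have hpos : ∀ᵐ ω ∂P, ∀ k, R k ω ≠ 0 := by
    refine ae_all_iff.2 fun k => ?_
    have := h.measureReal_step_eq_zero h1 (hR k) (hlaw k)
    rw [measureReal_eq_zero_iff] at this
    rw [ae_iff]
    simpa using this
  filter_upwards [hpos] with ω hω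
  rw [hsum]
  calc n = ∑ k ∈ Finset.range n, 1 := by simp
    _ ≤ _ := Finset.sum_le_sum fun k _ => Nat.one_le_iff_ne_zero.2 (hω k)

/-- Any bounded function of `T n` is integrable. -/
lemma IsDiscreteSubordinator.integrable_of_bound (hT : IsDiscreteSubordinator b ν P T) (n : ℕ)
    (f : ℕ → ℝ) {C : ℝ} (hC : ∀ᵐ ω ∂P, ‖f (T n ω)‖ ≤ C) : Integrable (fun ω => f (T n ω)) P :=
  Integrable.of_bound
    ((measurable_from_top (f := f)).comp (hT.measurable n)).aestronglyMeasurable C hC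

lemma IsDiscreteSubordinator.integrable_exp (hT : IsDiscreteSubordinator b ν P T) (n : ℕ)
    {u : ℝ} (hu : 0 ≤ u) : Integrable (fun ω => Real.exp (-u * (T n ω : ℝ))) P := by
  refine hT.integrable_of_bound n (fun m => Real.exp (-u * (m : ℝ))) (C := 1)
    (ae_of_all _ fun ω => ?_)
  rw [Real.norm_of_nonneg (Real.exp_pos _).le, Real.exp_le_one_iff]
  have : 0 ≤ u * (T n ω : ℝ) := by positivity
  linarith

/-- By independence the Laplace transform of `T n` is `(1 - φ (1 - e^{-u})) ^ n`. -/
lemma IsDiscreteSubordinator.integral_exp_le (hT : IsDiscreteSubordinator b ν P T)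
    (h : IsLevyPair b ν) (h1 : bernsteinFn b ν 1 = 1) (n : ℕ) {u : ℝ} (hu0 : 0 ≤ u) :
    ∫ ω, Real.exp (-u * (T n ω : ℝ)) ∂P
      ≤ Real.exp (-(n * bernsteinFn b ν (1 - Real.exp (-u)))) := by
  obtain ⟨R, hR, hind, hlaw, hsum⟩ := hT
  have hind' := hind.comp (fun _ m => (m : ℝ)) (fun _ => measurable_from_top)
  have hmgf := hind'.mgf_sum (t := -u) (fun k => measurable_from_top.comp (hR k)) (Finset.range n)
  have hstep : ∀ k, mgf ((fun m : ℕ => (m : ℝ)) ∘ R k) P (-u)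
      = 1 - bernsteinFn b ν (1 - Real.exp (-u)) := by
    intro k
    rw [← h.integral_pow_step h1 (hR k) (hlaw k) (Real.exp_pos _).le
      (Real.exp_le_one_iff.2 (by linarith)), mgf]
    refine integral_congr_ae (ae_of_all _ fun ω => ?_)
    simp only [Function.comp_apply]
    rw [← Real.exp_nat_mul, mul_comm]
  simp only [hstep, Finset.prod_const, Finset.card_range] at hmgf
  have heq : ∫ ω, Real.exp (-u * (T n ω : ℝ)) ∂P
      = (1 - bernsteinFn b ν (1 - Real.exp (-u))) ^ n := by
    rw [← hmgf, mgf]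
    refine integral_congr_ae (ae_of_all _ fun ω => ?_)
    simp [hsum]
  have hle : bernsteinFn b ν (1 - Real.exp (-u)) ≤ 1 := by
    refine le_of_le_of_eq ?_ h1
    exact h.bernsteinFn_mono (sub_nonneg.2 (Real.exp_le_one_iff.2 (neg_nonpos.2 hu0)))
      (by linarith [Real.exp_pos (-u)])
  rw [heq, ← mul_neg, Real.exp_nat_mul]
  exact pow_le_pow_left₀ (by linarith) (Real.one_sub_le_exp_neg _) n

/-- For `u ≤ 1` the argument `1 - e^{-u}` of `φ` may be replaced by `u`, at the cost of a
factor `1/2` in the exponent. -/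
lemma IsDiscreteSubordinator.integral_exp_le_half (hT : IsDiscreteSubordinator b ν P T)
    (h : IsLevyPair b ν) (h1 : bernsteinFn b ν 1 = 1) (n : ℕ) {u : ℝ} (hu0 : 0 ≤ u)
    (hu1 : u ≤ 1) :
    ∫ ω, Real.exp (-u * (T n ω : ℝ)) ∂P ≤ Real.exp (-(n * (bernsteinFn b ν u / 2))) := by
  refine (hT.integral_exp_le h h1 n hu0).trans ?_
  have h2 := h.mul_bernsteinFn_le (u := 1 / 2) (by norm_num) (by norm_num) hu0
  have h3 := h.bernsteinFn_mono (x := 1 / 2 * u) (y := 1 - Real.exp (-u)) (by positivity)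
    (by linarith [half_le_one_sub_exp_neg hu0 hu1])
  have h4 : bernsteinFn b ν u / 2 ≤ bernsteinFn b ν (1 - Real.exp (-u)) := by linarith
  gcongr

/-! ### Sub-exponential moments -/

/-- The pointwise bound `e^{-θ T^δ} ≤ e^{-θ t^δ} + e^{u (t - T)}` is integrated with
`t = τ n^{1/D}` and `u = n^{-(1-δ)/D}`, where `D = α (1 - δ) + δ`. All three quantities
`t^δ`, `u t` and `n u^α` are then of order `n^{δ/D}`. -/
lemma IsDiscreteSubordinator.integral_exp_rpow_le (hT : IsDiscreteSubordinator b ν P T)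
    (h : IsLevyPair b ν) (h1 : bernsteinFn b ν 1 = 1) {θ δ c α : ℝ} (hθ : 0 < θ) (hδ0 : 0 < δ)
    (hδ1 : δ ≤ 1) (hc : 0 < c) (hα0 : 0 < α) (hα1 : α < 1) (hν : StableLowerBound c α ν) {n : ℕ}
    (hn : 1 ≤ n) :
    ∫ ω, Real.exp (-θ * (T n ω : ℝ) ^ δ) ∂P
      ≤ Real.exp (-(θ * (c / 32) ^ δ) * (n : ℝ) ^ (δ / (α * (1 - δ) + δ)))
        + Real.exp (-(c / 32) * (n : ℝ) ^ (δ / (α * (1 - δ) + δ))) := by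
  set D := α * (1 - δ) + δ with hD
  have hD0 : 0 < D := by nlinarith
  have hn0 : (0 : ℝ) < n := by exact_mod_cast hn
  set t := c / 32 * (n : ℝ) ^ (1 / D) with ht
  set u := (n : ℝ) ^ (-((1 - δ) / D)) with hu
  have ht0 : 0 < t := by positivity
  have hu0 : 0 < u := by positivity
  have hu1 : u ≤ 1 := Real.rpow_le_one_of_one_le_of_nonpos (by exact_mod_cast hn)
    (neg_nonpos.2 (div_nonneg (by linarith) hD0.le))
  have htδ : t ^ δ = (c / 32) ^ δ * (n : ℝ) ^ (δ / D) := by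
    rw [ht, Real.mul_rpow (by positivity) (by positivity), ← Real.rpow_mul hn0.le]
    congr 2; ring
  have hut : u * t = c / 32 * (n : ℝ) ^ (δ / D) := by
    rw [ht, hu, mul_left_comm, ← Real.rpow_add hn0]
    congr 2; field_simp; ring
  have hnu : n * u ^ α = (n : ℝ) ^ (δ / D) := by
    rw [hu, ← Real.rpow_mul hn0.le]
    nth_rewrite 1 [← Real.rpow_one (n : ℝ)]
    rw [← Real.rpow_add hn0]
    congr 1; field_simp; rw [hD]; ring
  have hpt : ∀ ω, Real.exp (-θ * (T n ω : ℝ) ^ δ)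
      ≤ Real.exp (-θ * t ^ δ) + Real.exp (u * t) * Real.exp (-u * (T n ω : ℝ)) := by
    intro ω
    rcases le_total t (T n ω) with hle | hle
    · have h2 : t ^ δ ≤ (T n ω : ℝ) ^ δ := Real.rpow_le_rpow ht0.le hle hδ0.le
      have h3 : Real.exp (-θ * (T n ω : ℝ) ^ δ) ≤ Real.exp (-θ * t ^ δ) :=
        Real.exp_le_exp.2 (by nlinarith)
      linarith [mul_pos (Real.exp_pos (u * t)) (Real.exp_pos (-u * (T n ω : ℝ)))]
    · have h2 : Real.exp (-θ * (T n ω : ℝ) ^ δ) ≤ 1 := by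
        rw [Real.exp_le_one_iff, neg_mul, neg_nonpos]
        positivity
      have h3 : 1 ≤ Real.exp (u * t) * Real.exp (-u * (T n ω : ℝ)) := by
        rw [← Real.exp_add, Real.one_le_exp_iff]
        nlinarith
      linarith [Real.exp_pos (-θ * t ^ δ)]
  have hi := (hT.integrable_exp n hu0.le).const_mul (Real.exp (u * t))
  have hφ := h.le_bernsteinFn_of_stableLowerBound hc hα0 hα1 hν hu0
  calc ∫ ω, Real.exp (-θ * (T n ω : ℝ) ^ δ) ∂P
      ≤ ∫ ω, (Real.exp (-θ * t ^ δ) + Real.exp (u * t) * Real.exp (-u * (T n ω : ℝ))) ∂P :=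
        integral_mono_of_nonneg (ae_of_all _ fun ω => (Real.exp_pos _).le)
          ((integrable_const _).add hi) (ae_of_all _ hpt)
    _ = Real.exp (-θ * t ^ δ)
          + Real.exp (u * t) * ∫ ω, Real.exp (-u * (T n ω : ℝ)) ∂P := by
        rw [integral_add (integrable_const _) hi, integral_const_mul, integral_const,
          probReal_univ, one_smul]
    _ ≤ Real.exp (-θ * t ^ δ)
          + Real.exp (u * t) * Real.exp (-(n * (bernsteinFn b ν u / 2))) := by
        gcongr
        exact hT.integral_exp_le_half h h1 n hu0.le hu1
    _ ≤ _ := by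
        rw [← Real.exp_add]
        refine add_le_add (Real.exp_le_exp.2 (le_of_eq (by rw [htδ]; ring)))
          (Real.exp_le_exp.2 ?_)
        have : c / 8 * (n * u ^ α) ≤ n * bernsteinFn b ν u := by
          calc c / 8 * (n * u ^ α) = n * (c / 8 * u ^ α) := by ring
            _ ≤ _ := mul_le_mul_of_nonneg_left hφ hn0.le
        rw [hnu] at this
        rw [hut]
        linarith

/-- Two exponentially small terms are absorbed into one, with half the rate. -/
lemma eventually_exp_add_exp_le {A B κ : ℝ} (hA : 0 < A) (hB : 0 < B) (hκ : 0 < κ) :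
    ∀ᶠ n : ℕ in atTop, Real.exp (-A * (n : ℝ) ^ κ) + Real.exp (-B * (n : ℝ) ^ κ)
      ≤ Real.exp (-(min A B / 2) * (n : ℝ) ^ κ) := by
  have hm : 0 < min A B := lt_min hA hB
  have htend : Tendsto (fun n : ℕ => (n : ℝ) ^ κ) atTop atTop :=
    (tendsto_rpow_atTop hκ).comp tendsto_natCast_atTop_atTop
  filter_upwards [htend.eventually_ge_atTop (2 / min A B)] with n hn
  set x := (n : ℝ) ^ κ
  have hx : 0 < x := lt_of_lt_of_le (by positivity) hn
  have h1 : 1 ≤ min A B / 2 * x := by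
    rw [div_le_iff₀ hm] at hn
    linarith
  have h2 : 2 ≤ Real.exp (min A B / 2 * x) := by
    linarith [Real.add_one_le_exp (min A B / 2 * x)]
  have hA' : Real.exp (-A * x) ≤ Real.exp (-min A B * x) :=
    Real.exp_le_exp.2 (by nlinarith [min_le_left A B])
  have hB' : Real.exp (-B * x) ≤ Real.exp (-min A B * x) :=
    Real.exp_le_exp.2 (by nlinarith [min_le_right A B])
  calc _ ≤ 2 * Real.exp (-min A B * x) := by linarith
    _ ≤ Real.exp (min A B / 2 * x) * Real.exp (-min A B * x) := by gcongr
    _ = _ := by rw [← Real.exp_add]; congr 1; ring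

/-! ### Algebraic moments -/

/-- The scaling `φ (l x) ≥ ρ φ x` near `0` is iterated up to the threshold `l ^ (-M)`; beyond it
only monotonicity is used, which costs the factor `ρ ^ M`. -/
lemma exists_pow_mul_le_of_scaling {φ : ℝ → ℝ} (hmono : ∀ x y, 0 ≤ x → x ≤ y → φ x ≤ φ y)
    (hnn : ∀ x, 0 ≤ x → 0 ≤ φ x) {l ρ : ℝ} (hl : 1 < l) (hρ : 1 < ρ)
    (hscale : ∀ᶠ x in 𝓝[>] 0, ρ * φ x ≤ φ (l * x)) :
    ∃ M : ℕ, ∀ (x : ℝ) (k : ℕ), 0 < x → l ^ k * x ≤ 1 → ρ ^ k * φ x ≤ ρ ^ M * φ (l ^ k * x) := by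
  have hl0 : 0 < l := by linarith
  have hρ0 : 0 < ρ := by linarith
  obtain ⟨x₀, hx₀, hsub⟩ := mem_nhdsGT_iff_exists_Ioo_subset.1 hscale
  have hx₀ : 0 < x₀ := hx₀
  obtain ⟨M, hM⟩ := pow_unbounded_of_one_lt (1 / x₀) hl
  refine ⟨M, fun x k hx hk => ?_⟩
  have hiter : ∀ i : ℕ, l ^ i * x < x₀ * l → ρ ^ i * φ x ≤ φ (l ^ i * x) := by
    intro i
    induction i with
    | zero => simp
    | succ i ih =>
      intro hi
      have hi' : l ^ i * x < x₀ := by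
        rw [pow_succ] at hi
        nlinarith
      have h1 := ih (by nlinarith)
      have h2 : ρ * φ (l ^ i * x) ≤ φ (l * (l ^ i * x)) := hsub ⟨by positivity, hi'⟩
      calc ρ ^ (i + 1) * φ x = ρ * (ρ ^ i * φ x) := by ring
        _ ≤ ρ * φ (l ^ i * x) := by gcongr
        _ ≤ _ := by rw [pow_succ', mul_assoc]; exact h2
  rcases le_total k M with hkM | hkM
  · exact mul_le_mul (pow_le_pow_right₀ hρ.le hkM)
      (hmono _ _ hx.le (le_mul_of_one_le_left hx.le (one_le_pow₀ hl.le))) (hnn _ hx.le)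
      (by positivity)
  · obtain ⟨i, rfl⟩ := Nat.exists_eq_add_of_le hkM
    have hi : l ^ i * x < x₀ * l := by
      rw [div_lt_iff₀ hx₀] at hM
      rw [pow_add, mul_assoc] at hk
      have : 0 < l ^ i * x := by positivity
      have h3 : l ^ M * (l ^ i * x) < l ^ M * x₀ := by linarith
      have := lt_of_mul_lt_mul_left h3 (by positivity)
      nlinarith
    rw [pow_add, mul_assoc]
    gcongr
    refine (hiter i hi).trans (hmono _ _ (by positivity) ?_)
    gcongr
    · linarith
    · omega

lemma summable_pow_mul_exp_neg_pow {q κ ρ : ℝ} (hq : 0 < q) (hκ : 0 < κ) (hρ : 1 < ρ) :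
    Summable fun k : ℕ => q ^ k * Real.exp (-(κ * ρ ^ k)) := by
  have hρ0 : 0 < ρ := by linarith
  -- `e^{-x} ≤ j! / x^j` with `ρ ^ j > 2 q` gives a geometric majorant of ratio `1/2`
  obtain ⟨j, hj⟩ := pow_unbounded_of_one_lt (2 * q) hρ
  refine Summable.of_nonneg_of_le (fun k => by positivity) (fun k => ?_)
    (summable_geometric_two.mul_left (j.factorial / κ ^ j))
  have h1 := Real.pow_div_factorial_le_exp (κ * ρ ^ k) (by positivity) j
  have h2 : Real.exp (-(κ * ρ ^ k)) ≤ j.factorial / (κ * ρ ^ k) ^ j := by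
    rw [Real.exp_neg, ← inv_div]
    exact inv_anti₀ (by positivity) h1
  calc q ^ k * Real.exp (-(κ * ρ ^ k)) ≤ q ^ k * (j.factorial / (κ * ρ ^ k) ^ j) := by gcongr
    _ = j.factorial / κ ^ j * (q / ρ ^ j) ^ k := by
        rw [mul_pow, div_pow, ← pow_mul, ← pow_mul, mul_comm k j]
        field_simp
    _ ≤ j.factorial / κ ^ j * (1 / 2) ^ k := by
        gcongr ?_ * ?_ ^ k
        rw [div_le_iff₀ (by positivity)]
        linarith

/-- Pointwise layer-by-layer bound of `t ^ (-β)` by exponentials at the scales `l ^ k * a`. -/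
lemma rpow_neg_le_sum_exp {a β l t : ℝ} (ha : 0 < a) (hβ : 0 < β) (hl : 1 < l) (ht : 1 ≤ t)
    {N : ℕ} (hN : 1 < l ^ N * a) :
    t ^ (-β) ≤ a ^ β + ∑ k ∈ (Finset.range N).filter (fun k => l ^ k * a ≤ 1),
      a ^ β * ((l ^ β) ^ (k + 1) * (Real.exp 1 * Real.exp (-(l ^ k * a) * t))) := by
  have hl0 : 0 < l := by linarith
  have ht0 : 0 < t := by linarith
  have hnn : ∀ k : ℕ, 0 ≤ a ^ β * ((l ^ β) ^ (k + 1) *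
      (Real.exp 1 * Real.exp (-(l ^ k * a) * t))) := fun k => by positivity
  rw [Real.rpow_neg ht0.le, ← Real.inv_rpow ht0.le]
  rcases le_or_gt t⁻¹ a with hta | hta
  · exact (Real.rpow_le_rpow (by positivity) hta hβ.le).trans
      (le_add_of_nonneg_right (Finset.sum_nonneg fun k _ => hnn k))
  · -- the layer of `t` is the `k` with `l ^ k * a ≤ 1 / t < l ^ (k + 1) * a`
    obtain ⟨k, hk1, hk2⟩ := exists_nat_pow_near ((one_le_div ha).2 hta.le) hl
    rw [le_div_iff₀ ha] at hk1
    rw [div_lt_iff₀ ha] at hk2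
    have hk3 : l ^ k * a ≤ 1 := hk1.trans (inv_le_one_of_one_le₀ ht)
    have hkN : k < N := by
      by_contra! hNk
      have : l ^ N * a ≤ l ^ k * a := by gcongr; exact hl.le
      linarith
    have hterm : (t⁻¹) ^ β ≤ a ^ β * ((l ^ β) ^ (k + 1) *
        (Real.exp 1 * Real.exp (-(l ^ k * a) * t))) := by
      have h1 : 1 ≤ Real.exp 1 * Real.exp (-(l ^ k * a) * t) := by
        rw [← Real.exp_add, Real.one_le_exp_iff]
        have := mul_le_mul_of_nonneg_right hk1 ht0.le
        rw [inv_mul_cancel₀ ht0.ne'] at this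
        linarith
      calc (t⁻¹) ^ β ≤ (l ^ (k + 1) * a) ^ β := Real.rpow_le_rpow (by positivity) hk2.le hβ.le
        _ = a ^ β * ((l ^ β) ^ (k + 1) * 1) := by
            rw [Real.mul_rpow (by positivity) ha.le, Real.rpow_pow_comm hl0.le]
            ring
        _ ≤ _ := by gcongr
    refine hterm.trans (le_add_of_nonneg_of_le (by positivity) ?_)
    exact Finset.single_le_sum (f := fun k => a ^ β * ((l ^ β) ^ (k + 1) *
      (Real.exp 1 * Real.exp (-(l ^ k * a) * t)))) (fun k _ => hnn k)
      (Finset.mem_filter.2 ⟨Finset.mem_range.2 hkN, hk3⟩)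

lemma IsLevyPair.exists_scaling (h : IsLevyPair b ν) (h1 : bernsteinFn b ν 1 = 1)
    (hg : GrowthCondition (bernsteinFn b ν)) :
    ∃ l ρ : ℝ, 1 < l ∧ 1 < ρ ∧ ∃ M : ℕ, ∀ (x : ℝ) (k : ℕ), 0 < x → l ^ k * x ≤ 1 →
      ρ ^ k * bernsteinFn b ν x ≤ ρ ^ M * bernsteinFn b ν (l ^ k * x) := by
  obtain ⟨-, l, hl, hlim⟩ := hg
  obtain ⟨ρ, hρ1, hρ2⟩ := EReal.lt_iff_exists_real_btwn.1 hlim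
  have hρ : 1 < ρ := by exact_mod_cast hρ1
  refine ⟨l, ρ, hl, hρ, exists_pow_mul_le_of_scaling (fun x y => h.bernsteinFn_mono)
    (fun x hx => ?_) hl hρ ?_⟩
  · rw [← bernsteinFn_zero (b := b) (ν := ν)]
    exact h.bernsteinFn_mono le_rfl hx
  · filter_upwards [eventually_lt_of_lt_liminf hρ2, Ioo_mem_nhdsGT zero_lt_one] with x hx hx01
    have hφ : 0 < bernsteinFn b ν x := by
      have := h.mul_bernsteinFn_le hx01.1.le hx01.2.le zero_le_one
      rw [h1, mul_one] at this
      linarith [hx01.1]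
    exact ((lt_div_iff₀ hφ).1 (by exact_mod_cast hx)).le

lemma IsDiscreteSubordinator.integrable_rpow_neg (hT : IsDiscreteSubordinator b ν P T)
    (h : IsLevyPair b ν) (h1 : bernsteinFn b ν 1 = 1) {β : ℝ} (hβ : 0 < β) {n : ℕ} (hn : 1 ≤ n) :
    Integrable (fun ω => (T n ω : ℝ) ^ (-β)) P := by
  refine hT.integrable_of_bound n (fun m => (m : ℝ) ^ (-β)) (C := 1) ?_
  filter_upwards [hT.ae_le h h1 n] with ω hω
  rw [Real.norm_of_nonneg (by positivity)]
  exact Real.rpow_le_one_of_one_le_of_nonpos (by exact_mod_cast hn.trans hω) (by linarith)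

/-- At the scale `a = φ⁻¹ (1 / n)`, the exponential moment of order `l ^ k * a ≤ 1` is at most
`exp (-ρ ^ k / (2 ρ ^ M))`, uniformly in `n`. -/
lemma IsDiscreteSubordinator.integral_rpow_neg_le (hT : IsDiscreteSubordinator b ν P T)
    (h : IsLevyPair b ν) (h1 : bernsteinFn b ν 1 = 1) {l ρ : ℝ} (hl : 1 < l) (hρ : 1 < ρ) {M : ℕ}
    (hscale : ∀ (x : ℝ) (k : ℕ), 0 < x → l ^ k * x ≤ 1 →
      ρ ^ k * bernsteinFn b ν x ≤ ρ ^ M * bernsteinFn b ν (l ^ k * x))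
    {β : ℝ} (hβ : 0 < β) {n : ℕ} (hn : 1 ≤ n) :
    ∫ ω, (T n ω : ℝ) ^ (-β) ∂P
      ≤ (1 + l ^ β * Real.exp 1 * ∑' k : ℕ, (l ^ β) ^ k * Real.exp (-(1 / (2 * ρ ^ M) * ρ ^ k)))
        * bernsteinInv b ν (1 / (n : ℝ)) ^ β := by
  have hl0 : 0 < l := by linarith
  have hρ0 : 0 < ρ := by linarith
  have hn0 : (0 : ℝ) < n := by exact_mod_cast hn
  obtain ⟨ha, hφa⟩ := h.bernsteinInv_spec h1 (one_div_pos.2 hn0)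
    ((div_le_one hn0).2 (by exact_mod_cast hn))
  set a := bernsteinInv b ν (1 / (n : ℝ))
  obtain ⟨N, hN⟩ := pow_unbounded_of_one_lt (1 / a) hl
  rw [div_lt_iff₀ ha] at hN
  set S := (Finset.range N).filter (fun k => l ^ k * a ≤ 1)
  have hi : ∀ k ∈ S, Integrable (fun ω => a ^ β * ((l ^ β) ^ (k + 1) *
      (Real.exp 1 * Real.exp (-(l ^ k * a) * (T n ω : ℝ))))) P := fun k _ =>
    (((hT.integrable_exp n (by positivity)).const_mul _).const_mul _).const_mul _
  have hexp : ∀ k ∈ S, ∫ ω, Real.exp (-(l ^ k * a) * (T n ω : ℝ)) ∂P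
      ≤ Real.exp (-(1 / (2 * ρ ^ M) * ρ ^ k)) := by
    intro k hk
    have hk1 := (Finset.mem_filter.1 hk).2
    refine (hT.integral_exp_le_half h h1 n (by positivity) hk1).trans ?_
    rw [Real.exp_le_exp, neg_le_neg_iff]
    have h2 := hscale a k ha hk1
    rw [hφa, mul_one_div, div_le_iff₀ hn0] at h2
    rw [one_div_mul_eq_div, div_le_iff₀ (by positivity)]
    linarith
  have hsum := summable_pow_mul_exp_neg_pow (q := l ^ β) (κ := 1 / (2 * ρ ^ M)) (ρ := ρ)
    (by positivity) (by positivity) hρ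
  calc ∫ ω, (T n ω : ℝ) ^ (-β) ∂P
      ≤ ∫ ω, (a ^ β + ∑ k ∈ S, a ^ β * ((l ^ β) ^ (k + 1) *
          (Real.exp 1 * Real.exp (-(l ^ k * a) * (T n ω : ℝ))))) ∂P := by
        refine integral_mono_ae (hT.integrable_rpow_neg h h1 hβ hn)
          ((integrable_const _).add (integrable_finsetSum _ hi)) ?_
        filter_upwards [hT.ae_le h h1 n] with ω hω
        exact rpow_neg_le_sum_exp ha hβ hl (by exact_mod_cast hn.trans hω) hN
    _ = a ^ β + ∑ k ∈ S, a ^ β * ((l ^ β) ^ (k + 1) *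
          (Real.exp 1 * ∫ ω, Real.exp (-(l ^ k * a) * (T n ω : ℝ)) ∂P)) := by
        rw [integral_add (integrable_const _) (integrable_finsetSum _ hi),
          integral_finsetSum _ hi]
        simp only [integral_const_mul, integral_const, probReal_univ, one_smul]
    _ ≤ a ^ β + ∑ k ∈ S, a ^ β * ((l ^ β) ^ (k + 1) *
          (Real.exp 1 * Real.exp (-(1 / (2 * ρ ^ M) * ρ ^ k)))) := by
        gcongr with k hk
        exact hexp k hk
    _ = a ^ β + a ^ β * (l ^ β * Real.exp 1) *
          ∑ k ∈ S, (l ^ β) ^ k * Real.exp (-(1 / (2 * ρ ^ M) * ρ ^ k)) := by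
        rw [Finset.mul_sum]
        congr 1
        exact Finset.sum_congr rfl fun k _ => by ring
    _ ≤ a ^ β + a ^ β * (l ^ β * Real.exp 1) *
          ∑' k : ℕ, (l ^ β) ^ k * Real.exp (-(1 / (2 * ρ ^ M) * ρ ^ k)) := by
        gcongr
        exact hsum.sum_le_tsum _ fun k _ => by positivity
    _ = _ := by ring

end DiscreteSubordination

/-! ### The three moment estimates -/

theorem theorem2 :
    -- (a) sub-exponential moments
    (∀ θ δ c α : ℝ, 0 < θ → 0 < δ → δ ≤ 1 → 0 < c → 0 < α → α < 1 →
      ∃ C : ℝ, 0 < C ∧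
        ∀ (b : ℝ) (ν : Measure ℝ), DiscreteSubordination.IsLevyPair b ν →
          DiscreteSubordination.bernsteinFn b ν 1 = 1 →
          DiscreteSubordination.StableLowerBound c α ν →
          ∀ (Ω : Type*) [MeasurableSpace Ω] (P : Measure Ω) [IsProbabilityMeasure P]
            (T : ℕ → Ω → ℕ), DiscreteSubordination.IsDiscreteSubordinator b ν P T →
            ∀ᶠ n : ℕ in atTop,
              Integrable (fun ω => Real.exp (-θ * (T n ω : ℝ) ^ δ)) P ∧
              ∫ ω, Real.exp (-θ * (T n ω : ℝ) ^ δ) ∂P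
                ≤ Real.exp (-C * (n : ℝ) ^ (δ / (α * (1 - δ) + δ)))) ∧
    -- (b) algebraic moments
    (∀ (b : ℝ) (ν : Measure ℝ), DiscreteSubordination.IsLevyPair b ν →
      DiscreteSubordination.bernsteinFn b ν 1 = 1 →
      DiscreteSubordination.GrowthCondition (DiscreteSubordination.bernsteinFn b ν) →
      ∀ β : ℝ, 0 < β →
      ∃ C : ℝ, 0 < C ∧
        ∀ (Ω : Type*) [MeasurableSpace Ω] (P : Measure Ω) [IsProbabilityMeasure P]
          (T : ℕ → Ω → ℕ), DiscreteSubordination.IsDiscreteSubordinator b ν P T →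
          ∀ n : ℕ, 1 ≤ n →
            Integrable (fun ω => (T n ω : ℝ) ^ (-β)) P ∧
            ∫ ω, (T n ω : ℝ) ^ (-β) ∂P
              ≤ C * (DiscreteSubordination.bernsteinInv b ν (1 / (n : ℝ))) ^ β) ∧
    -- (c) logarithmic moments
    (∀ γ c α : ℝ, 0 < γ → 0 < c → 0 < α → α < 1 →
      ∃ C : ℝ, 0 < C ∧
        ∀ (b : ℝ) (ν : Measure ℝ), DiscreteSubordination.IsLevyPair b ν →
          DiscreteSubordination.bernsteinFn b ν 1 = 1 →
          DiscreteSubordination.StableLowerBound c α ν →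
          ∀ (Ω : Type*) [MeasurableSpace Ω] (P : Measure Ω) [IsProbabilityMeasure P]
            (T : ℕ → Ω → ℕ), DiscreteSubordination.IsDiscreteSubordinator b ν P T →
            ∀ n : ℕ, 1 ≤ n →
              Integrable (fun ω => Real.log (1 + (T n ω : ℝ)) ^ (-γ)) P ∧
              ∫ ω, Real.log (1 + (T n ω : ℝ)) ^ (-γ) ∂P
                ≤ C * Real.log (1 + (n : ℝ)) ^ (-γ)) := by
  refine ⟨?_, ?_, ?_⟩
  · intro θ δ c α hθ hδ0 hδ1 hc hα0 hα1
    have hA : 0 < θ * (c / 32) ^ δ := by positivity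
    have hB : 0 < c / 32 := by positivity
    have hκ : 0 < δ / (α * (1 - δ) + δ) :=
      div_pos hδ0 (add_pos_of_nonneg_of_pos (mul_nonneg hα0.le (by linarith)) hδ0)
    refine ⟨min (θ * (c / 32) ^ δ) (c / 32) / 2, half_pos (lt_min hA hB), ?_⟩
    intro b ν h h1 hν Ω _ P _ T hT
    filter_upwards [DiscreteSubordination.eventually_exp_add_exp_le hA hB hκ,
      eventually_ge_atTop 1] with n hn hn1
    refine ⟨?_, (hT.integral_exp_rpow_le h h1 hθ hδ0 hδ1 hc hα0 hα1 hν hn1).trans hn⟩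
    refine hT.integrable_of_bound n (fun m => Real.exp (-θ * (m : ℝ) ^ δ)) (C := 1)
      (ae_of_all _ fun ω => ?_)
    rw [Real.norm_of_nonneg (Real.exp_pos _).le, Real.exp_le_one_iff, neg_mul, neg_nonpos]
    positivity
  · intro b ν h h1 hg β hβ
    obtain ⟨l, ρ, hl, hρ, M, hscale⟩ := h.exists_scaling h1 hg
    have hl0 : 0 < l := by linarith
    have hsum : 0 ≤ ∑' k : ℕ, (l ^ β) ^ k * Real.exp (-(1 / (2 * ρ ^ M) * ρ ^ k)) :=
      tsum_nonneg fun k => by positivity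
    refine ⟨_, by positivity, fun Ω _ P _ T hT n hn => ⟨hT.integrable_rpow_neg h h1 hβ hn,
      hT.integral_rpow_neg_le h h1 hl hρ hscale hβ hn⟩⟩
  · intro γ c α hγ _ _ _
    refine ⟨1, one_pos, fun b ν h h1 _ Ω _ P _ T hT n hn => ?_⟩
    -- since `T n ≥ n` a.s., the integrand is bounded by its value at `n`
    have hn1 : (1 : ℝ) ≤ n := by exact_mod_cast hn
    have hle : ∀ᵐ ω ∂P, Real.log (1 + (T n ω : ℝ)) ^ (-γ) ≤ Real.log (1 + (n : ℝ)) ^ (-γ) := by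
      filter_upwards [hT.ae_le h h1 n] with ω hω
      have hω' : (n : ℝ) ≤ T n ω := by exact_mod_cast hω
      exact Real.rpow_le_rpow_of_nonpos (Real.log_pos (by linarith))
        (Real.log_le_log (by linarith) (by linarith)) (by linarith)
    have hint : Integrable (fun ω => Real.log (1 + (T n ω : ℝ)) ^ (-γ)) P := by
      refine hT.integrable_of_bound n (fun m => Real.log (1 + (m : ℝ)) ^ (-γ))
        (C := Real.log (1 + (n : ℝ)) ^ (-γ)) ?_
      filter_upwards [hle] with ω hω
      have : 0 ≤ Real.log (1 + (T n ω : ℝ)) :=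
        Real.log_nonneg (le_add_of_nonneg_right (Nat.cast_nonneg _))
      rwa [Real.norm_of_nonneg (by positivity)]
    refine ⟨hint, ?_⟩
    calc _ ≤ ∫ _, Real.log (1 + (n : ℝ)) ^ (-γ) ∂P :=
          integral_mono_ae hint (integrable_const _) hle
      _ = _ := by rw [integral_const, probReal_univ, one_smul, one_mul]
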